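/- Let $\mathcal{L}_G$ be the first-order language of groups (multiplication, inverse, identity). Call a subgroup of a group $G$ \emph{definable} if it is the set $\phi(G,\bar a)=\{x\in G : G\models\phi(x,\bar a)\}$ for some $\mathcal{L}_G$-formula $\phi(x,\bar y)$ and some tuple $\bar a$ of parameters from $G$, and let the \emph{definable Fitting subgroup} $dF(G)$ be the subgroup of $G$ generated by all definable normal nilpotent subgroups of $G$. Let $G$ be a group and suppose that $dF(G)$ coincides with a definable nilpotent subgroup $\phi(G,\bar a)$ of $G$. Then $dF(G)$ is $\emptyset$-definable in $\mathrm{Th}(G)$, the complete theory of $G$ in the language $\mathcal{L}_G$: there is an $\mathcal{L}_G$-formula $\psi(x)$ without parameters such that $dF(G')=\psi(G')$ for every group $G'$ that is a model of $\mathrm{Th}(G)$ (in particular for $G'=G$). -/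

import Mathlib

universe u v

namespace FirstOrder

/-- The function symbols of the language of groups: multiplication, inverse and identity. -/
inductive GroupFunc : ℕ → Type
  | mul : GroupFunc 2
  | inv : GroupFunc 1
  | one : GroupFunc 0

/-- The first-order language of groups; it has no relation symbols besides equality. -/
def Language.groups : Language.{0, 0} where
  Functions := GroupFunc
  Relations := fun _ => Empty

/-- Every group is a structure for the language of groups, in the standard way. -/
instance groupStructure (G : Type*) [Group G] : Language.groups.Structure G where
  funMap := fun {_} f =>
    match f with
    | .mul => fun x => x 0 * x 1
    | .inv => fun x => (x 0)⁻¹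
    | .one => fun _ => 1
  RelMap := fun {_} r => r.elim

/-- A subgroup is definable if its underlying set is defined in the pure group by a first-order
formula of the language of groups, with parameters from the group. -/
def SubgroupDefinable {G : Type*} [Group G] (H : Subgroup G) : Prop :=
  (Set.univ : Set G).Definable₁ Language.groups (H : Set G)

/-- The definable Fitting group: the subgroup generated by all definable normal nilpotent
subgroups. -/
def definableFitting (G : Type*) [Group G] : Subgroup G :=
  Subgroup.closure {x | ∃ H : Subgroup G,
    SubgroupDefinable H ∧ H.Normal ∧ Group.IsNilpotent H ∧ x ∈ H}

end FirstOrder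

/-! Let dF(G) be defined by θ(x, a) and have class at most n. That θ(x, v) defines a normal
nilpotent subgroup of class at most n is a first-order condition on v, so the union of all such sets
is defined by a formula ψ without parameters. In G each of these sets lies in dF(G), and v = a gives
all of it, so ψ(G) = dF(G).

Two kinds of sentence then pass to a model G'. One says that ψ defines a normal nilpotent subgroup,
whence ψ(G') ≤ dF(G'). The others, one for each formula χ and class bound m, say that every normal
nilpotent χ(x, c) of class at most m lies inside ψ; they hold in G by the definition of dF(G), and
in G' they give dF(G') ≤ ψ(G'). -/

namespace FirstOrder

open FirstOrder.Language

/-! ### Normal nilpotent subgroups as sets -/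

section Carrier

variable {G : Type*} [Group G]

/-- The elements `x` all of whose left-normed commutators with `n` elements of `X` are trivial. -/
def relUpperCentral (X : Set G) : ℕ → G → Prop
  | 0, x => x = 1
  | n + 1, x => ∀ y ∈ X, relUpperCentral X n (x * y * x⁻¹ * y⁻¹)

/-- `X` is the underlying set of a normal subgroup which is nilpotent of class at most `n`. -/
def IsNormalNilpotentSet (n : ℕ) (X : Set G) : Prop :=
  1 ∈ X ∧ (∀ x y, x ∈ X → y ∈ X → x * y ∈ X) ∧ (∀ x ∈ X, x⁻¹ ∈ X) ∧
    (∀ x g, x ∈ X → g * x * g⁻¹ ∈ X) ∧ ∀ x ∈ X, relUpperCentral X n x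

/-- Both sides obey the same recursion: an element is in the next term when its commutators with all
of `H` are in the current one. -/
theorem relUpperCentral_iff (H : Subgroup G) (n : ℕ) (x : H) :
    relUpperCentral (H : Set G) n x ↔ x ∈ Subgroup.upperCentralSeries H n := by
  induction n generalizing x with
  | zero => simp [relUpperCentral]
  | succ n ih =>
    rw [Subgroup.mem_upperCentralSeries_succ_iff]
    simp only [relUpperCentral, ← ih, SetLike.mem_coe, Subtype.forall, commutatorElement_def]
    rfl

theorem exists_isNormalNilpotentSet (H : Subgroup G) (hH : H.Normal) (hn : Group.IsNilpotent H) :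
    ∃ n, IsNormalNilpotentSet n (H : Set G) := by
  obtain ⟨n, hn⟩ := hn.nilpotent'
  refine ⟨n, H.one_mem, fun _ _ => H.mul_mem, fun _ => H.inv_mem,
    fun x g hx => hH.conj_mem x hx g, fun x hx => ?_⟩
  exact (relUpperCentral_iff H n ⟨x, hx⟩).2 (hn ▸ Subgroup.mem_top _)

theorem IsNormalNilpotentSet.exists_subgroup {n : ℕ} {X : Set G} (h : IsNormalNilpotentSet n X) :
    ∃ H : Subgroup G, (H : Set G) = X ∧ H.Normal ∧ Group.IsNilpotent H := by
  obtain ⟨h1, hmul, hinv, hconj, hn⟩ := h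
  let H : Subgroup G :=
    { carrier := X
      one_mem' := h1
      mul_mem' := fun {x y} => hmul x y
      inv_mem' := fun {x} => hinv x }
  refine ⟨H, rfl, ⟨fun x hx g => hconj x g hx⟩, ⟨n, ?_⟩⟩
  rw [eq_top_iff]
  exact fun x _ => (relUpperCentral_iff H n x).1 (hn x x.2)

/-- A definable normal nilpotent set lies in the definable Fitting subgroup. -/
theorem IsNormalNilpotentSet.subset_definableFitting {n : ℕ} {X : Set G}
    (h : IsNormalNilpotentSet n X) (hX : (Set.univ : Set G).Definable₁ Language.groups X) :
    X ⊆ definableFitting G := by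
  obtain ⟨H, rfl, hnor, hnil⟩ := h.exists_subgroup
  exact fun x hx => Subgroup.subset_closure ⟨H, hX, hnor, hnil, hx⟩

/-- The generating set is a union of normal subgroups, hence closed under conjugation. -/
theorem definableFitting_normal : (definableFitting G).Normal := by
  have hS : ∀ x ∈ {x : G | ∃ H : Subgroup G,
      SubgroupDefinable H ∧ H.Normal ∧ Group.IsNilpotent H ∧ x ∈ H}, ∀ g : G, g * x * g⁻¹ ∈
        {x : G | ∃ H : Subgroup G,
          SubgroupDefinable H ∧ H.Normal ∧ Group.IsNilpotent H ∧ x ∈ H} := by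
    rintro x ⟨H, hd, hnor, hnil, hx⟩ g
    exact ⟨H, hd, hnor, hnil, hnor.conj_mem x hx g⟩
  refine ⟨fun x hx g => ?_⟩
  have hle : definableFitting G ≤ (definableFitting G).comap (MulAut.conj g).toMonoidHom :=
    (Subgroup.closure_le _).2 fun y hy => Subgroup.subset_closure (hS y hy g)
  exact hle hx

end Carrier

/-! ### Expressing normality and bounded class by formulas -/

section Formulas

variable {β γ : Type*}

/-- The set defined by `θ` with parameters `v`. -/
def paramSet {G : Type*} [Group G] (θ : Language.groups.Formula (β ⊕ Fin 1)) (v : β → G) : Set G :=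
  {x | θ.Realize (Sum.elim v fun _ => x)}

/-- The formula `θ` with the term `t` substituted for its distinguished variable. -/
def substTerm (θ : Language.groups.Formula (β ⊕ Fin 1)) (t : Language.groups.Term (β ⊕ γ)) :
    Language.groups.Formula (β ⊕ γ) :=
  BoundedFormula.subst θ (Sum.elim (fun b => Term.var (Sum.inl b)) fun _ => t)

def mulTerm {α : Type*} (s t : Language.groups.Term α) : Language.groups.Term α :=
  Functions.apply₂ (L := Language.groups) GroupFunc.mul s t

def invTerm {α : Type*} (t : Language.groups.Term α) : Language.groups.Term α :=
  Functions.apply₁ (L := Language.groups) GroupFunc.inv t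

def oneTerm {α : Type*} : Language.groups.Term α :=
  Constants.term (L := Language.groups) GroupFunc.one

def commTerm {α : Type*} (s t : Language.groups.Term α) : Language.groups.Term α :=
  mulTerm (mulTerm (mulTerm s t) (invTerm s)) (invTerm t)

section Realize

variable {G : Type*} [Group G] {α : Type*} (w : α → G) (s t : Language.groups.Term α)

@[simp] theorem realize_mulTerm : (mulTerm s t).realize w = s.realize w * t.realize w := by
  simp only [mulTerm]
  rfl

@[simp] theorem realize_invTerm : (invTerm t).realize w = (t.realize w)⁻¹ := by
  simp only [invTerm]
  rfl

@[simp] theorem realize_oneTerm : (oneTerm : Language.groups.Term α).realize w = 1 := by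
  simp only [oneTerm]
  rfl

@[simp] theorem realize_substTerm (θ : Language.groups.Formula (β ⊕ Fin 1))
    (t : Language.groups.Term (β ⊕ γ)) (v : β → G) (i : γ → G) :
    (substTerm θ t).Realize (Sum.elim v i) ↔ t.realize (Sum.elim v i) ∈ paramSet θ v := by
  rw [substTerm, Formula.Realize, BoundedFormula.realize_subst, paramSet, Set.mem_ofPred_eq,
    Formula.Realize]
  refine iff_of_eq (congrArg (fun u => BoundedFormula.Realize θ u _) ?_)
  ext (b | b) <;> rfl

end Realize

/-- The variable `i` of the right summand, as a term. -/
def rvar (i : γ) : Language.groups.Term (β ⊕ γ) := Term.var (Sum.inr i)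

@[simp] theorem realize_rvar {G : Type*} [Group G] (v : β → G) (w : γ → G) (i : γ) :
    (rvar i : Language.groups.Term (β ⊕ γ)).realize (Sum.elim v w) = w i := rfl

theorem forall_fin_two {G : Type*} {p : G → G → Prop} :
    (∀ i : Fin 2 → G, p (i 0) (i 1)) ↔ ∀ x y, p x y :=
  ⟨fun h x y => h ![x, y], fun h _ => h _ _⟩

theorem forall_fin_one {G : Type*} {p : G → Prop} :
    (∀ i : Fin 1 → G, p (i 0)) ↔ ∀ x, p x :=
  ⟨fun h x => h ![x], fun h _ => h _⟩

/-- The formula expressing `relUpperCentral`. -/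
noncomputable def relUpperCentralFormula (θ : Language.groups.Formula (β ⊕ Fin 1)) :
    ℕ → Language.groups.Formula (β ⊕ Fin 1)
  | 0 => Term.equal (rvar 0) oneTerm
  | n + 1 => Formula.iAlls (Fin 1) <|
      Formula.relabel (Sum.elim (fun b => Sum.inl (Sum.inl b)) ![Sum.inl (Sum.inr 0), Sum.inr 0])
        (BoundedFormula.imp (substTerm θ (rvar 1))
          (substTerm (relUpperCentralFormula θ n) (commTerm (rvar 0) (rvar 1))) :
            Language.groups.Formula (β ⊕ Fin 2))

theorem paramSet_relUpperCentralFormula {G : Type*} [Group G]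
    (θ : Language.groups.Formula (β ⊕ Fin 1)) (v : β → G) (n : ℕ) (x : G) :
    x ∈ paramSet (relUpperCentralFormula θ n) v ↔ relUpperCentral (paramSet θ v) n x := by
  induction n generalizing x with
  | zero => simp [paramSet, relUpperCentralFormula, relUpperCentral]
  | succ n ih =>
    simp only [relUpperCentral, ← ih]
    rw [paramSet, Set.mem_ofPred_eq, relUpperCentralFormula, Formula.realize_iAlls]
    refine Iff.trans (forall_congr' fun i => ?_) (forall_fin_one (p := fun y =>
      y ∈ paramSet θ v → x * y * x⁻¹ * y⁻¹ ∈ paramSet (relUpperCentralFormula θ n) v))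
    have hw : ((fun a => Sum.elim (Sum.elim v fun _ : Fin 1 => x) i a) ∘
        (Sum.elim (fun b => Sum.inl (Sum.inl b)) ![Sum.inl (Sum.inr 0), Sum.inr 0] :
          β ⊕ Fin 2 → (β ⊕ Fin 1) ⊕ Fin 1)) = Sum.elim v ![x, i 0] := by
      ext (b | b)
      · rfl
      · fin_cases b <;> rfl
    rw [Formula.realize_relabel, hw, Formula.realize_imp]
    simp [commTerm]

/-- The formula, in the parameters of `θ`, expressing `IsNormalNilpotentSet`. -/
noncomputable def normalNilpotentFormula (n : ℕ) (θ : Language.groups.Formula (β ⊕ Fin 1)) :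
    Language.groups.Formula β :=
  Formula.iAlls (Fin 2) <|
    substTerm θ oneTerm ⊓
      (BoundedFormula.imp (substTerm θ (rvar 0))
          (BoundedFormula.imp (substTerm θ (rvar 1)) (substTerm θ (mulTerm (rvar 0) (rvar 1)))) ⊓
        (BoundedFormula.imp (substTerm θ (rvar 0)) (substTerm θ (invTerm (rvar 0))) ⊓
          (BoundedFormula.imp (substTerm θ (rvar 0))
              (substTerm θ (mulTerm (mulTerm (rvar 1) (rvar 0)) (invTerm (rvar 1)))) ⊓
            BoundedFormula.imp (substTerm θ (rvar 0))
              (substTerm (relUpperCentralFormula θ n) (rvar 0)))))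

theorem realize_normalNilpotentFormula {G : Type*} [Group G] (n : ℕ)
    (θ : Language.groups.Formula (β ⊕ Fin 1)) (v : β → G) :
    (normalNilpotentFormula n θ).Realize v ↔ IsNormalNilpotentSet n (paramSet θ v) := by
  rw [normalNilpotentFormula, Formula.realize_iAlls]
  simp only [Formula.realize_inf, Formula.realize_imp, realize_substTerm, realize_rvar,
    realize_oneTerm, realize_mulTerm, realize_invTerm, paramSet_relUpperCentralFormula]
  rw [forall_fin_two (p := fun x y => 1 ∈ paramSet θ v ∧
    (x ∈ paramSet θ v → y ∈ paramSet θ v → x * y ∈ paramSet θ v) ∧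
    (x ∈ paramSet θ v → x⁻¹ ∈ paramSet θ v) ∧
    (x ∈ paramSet θ v → y * x * y⁻¹ ∈ paramSet θ v) ∧
    (x ∈ paramSet θ v → relUpperCentral (paramSet θ v) n x))]
  -- All clauses share one block of two quantifiers; `1` fills those a clause does not use.
  exact ⟨fun h => ⟨(h 1 1).1, fun x y => (h x y).2.1, fun x => (h x 1).2.2.1,
    fun x y => (h x y).2.2.2.1, fun x => (h x 1).2.2.2.2⟩,
    fun h x y => ⟨h.1, h.2.1 x y, h.2.2.1 x, h.2.2.2.1 x y, h.2.2.2.2 x⟩⟩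

/-- The union of the sets `paramSet θ v` that are normal nilpotent of class at most `n`, as a
formula without parameters. -/
noncomputable def unionFormula [Finite β] (n : ℕ) (θ : Language.groups.Formula (β ⊕ Fin 1)) :
    Language.groups.Formula (Fin 1) :=
  Formula.iExs β <| Formula.relabel Sum.swap
    (Formula.relabel Sum.inl (normalNilpotentFormula n θ) ⊓ θ)

theorem realize_unionFormula {G : Type*} [Group G] [Finite β] (n : ℕ)
    (θ : Language.groups.Formula (β ⊕ Fin 1)) (x : G) :
    (unionFormula n θ).Realize (fun _ => x) ↔
      ∃ v : β → G, IsNormalNilpotentSet n (paramSet θ v) ∧ x ∈ paramSet θ v := by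
  rw [unionFormula, Formula.realize_iExs]
  refine exists_congr fun v => ?_
  have hw : Sum.elim (fun _ : Fin 1 => x) v ∘ Sum.swap = Sum.elim v fun _ => x := by
    ext (b | b) <;> rfl
  rw [Formula.realize_relabel, hw, Formula.realize_inf, Formula.realize_relabel,
    Sum.elim_comp_inl, realize_normalNilpotentFormula]
  rfl

/-! ### Transfer to models of the complete theory -/

/-- Validity of a formula with finitely many variables passes to models of the complete theory. -/
theorem forall_realize_of_model {G : Type u} [Group G] {G' : Type v} [Group G'] [Finite β]
    (h : Theory.Model G' (Language.groups.completeTheory G)) (φ : Language.groups.Formula β)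
    (hφ : ∀ w : β → G, φ.Realize w) (w : β → G') : φ.Realize w := by
  let σ : Language.groups.Sentence := Formula.iAlls β (φ.relabel Sum.inr)
  have hσ : G ⊨ σ := by
    refine Formula.realize_iAlls.2 fun i => ?_
    rw [Formula.realize_relabel]
    exact hφ _
  have hσ' : G' ⊨ σ := h.realize_of_mem σ hσ
  have := Formula.realize_iAlls.1 hσ' w
  rw [Formula.realize_relabel] at this
  exact this

theorem paramSet_definable {G : Type*} [Group G] (θ : Language.groups.Formula (β ⊕ Fin 1))
    (v : β → G) : (Set.univ : Set G).Definable₁ Language.groups (paramSet θ v) := by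
  refine Set.definable_iff_exists_formula_sum.2
    ⟨θ.relabel (Sum.map (fun b => ⟨v b, trivial⟩) id), ?_⟩
  ext x
  simp only [Set.mem_ofPred_eq, Formula.realize_relabel, paramSet]
  refine iff_of_eq (congrArg θ.Realize ?_)
  ext (b | b)
  · rfl
  · exact congrArg x (Subsingleton.elim _ _)

/-- A formula mentions only finitely many parameters, so they can be quantified over in a sentence.
-/
theorem exists_paramSet_eq {G : Type u} [Group G] {X : Set G}
    (hX : (Set.univ : Set G).Definable₁ Language.groups X) :
    ∃ (β : Type u) (_ : Finite β) (θ : Language.groups.Formula (β ⊕ Fin 1)) (v : β → G),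
      paramSet θ v = X := by
  obtain ⟨A, -, hA⟩ := Set.definable_iff_finitely_definable.1 hX
  obtain ⟨θ, hθ⟩ := Set.definable_iff_exists_formula_sum.1 hA
  refine ⟨_, A.finite_toSet, θ, (↑), ?_⟩
  ext x
  exact (Set.ext_iff.1 hθ fun _ => x).symm

/-- Inclusion of all normal nilpotent sets of bounded class in a given family into a set definable
without parameters passes to models of the complete theory. -/
theorem realize_of_isNormalNilpotentSet_of_model {G : Type u} [Group G] {G' : Type v} [Group G']
    [Finite β] (h : Theory.Model G' (Language.groups.completeTheory G))
    (χ : Language.groups.Formula (β ⊕ Fin 1)) {ψ : Language.groups.Formula (Fin 1)} {m : ℕ}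
    (hψ : ∀ c : β → G, IsNormalNilpotentSet m (paramSet χ c) →
      ∀ z ∈ paramSet χ c, ψ.Realize fun _ => z)
    {b : β → G'} (hb : IsNormalNilpotentSet m (paramSet χ b)) {y : G'} (hy : y ∈ paramSet χ b) :
    ψ.Realize fun _ => y := by
  let σ : Language.groups.Formula (β ⊕ Fin 1) :=
    Formula.imp (Formula.relabel Sum.inl (normalNilpotentFormula m χ))
      (Formula.imp χ (Formula.relabel Sum.inr ψ))
  have hσ := forall_realize_of_model h σ (fun w => ?_) (Sum.elim b fun _ => y)
  · simp only [σ, Formula.realize_imp, Formula.realize_relabel, Sum.elim_comp_inl,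
      Sum.elim_comp_inr, realize_normalNilpotentFormula] at hσ
    exact hσ hb hy
  · obtain ⟨c, z, rfl⟩ : ∃ (c : β → G) (z : G), w = Sum.elim c fun _ => z := by
      refine ⟨w ∘ Sum.inl, w (Sum.inr 0), ?_⟩
      ext (i | i)
      · rfl
      · rw [Subsingleton.elim i 0]; rfl
    simp only [σ, Formula.realize_imp, Formula.realize_relabel, Sum.elim_comp_inl,
      Sum.elim_comp_inr, realize_normalNilpotentFormula]
    exact fun hc hz => hψ c hc z hz

theorem mem_paramSet_relabel_inr {G : Type*} [Group G] (ψ : Language.groups.Formula (Fin 1))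
    {v : β → G} {x : G} :
    x ∈ paramSet (ψ.relabel Sum.inr) v ↔ ψ.Realize fun _ => x := by
  rw [paramSet, Set.mem_ofPred_eq, Formula.realize_relabel, Sum.elim_comp_inr]

theorem definableFitting_eq_of_model {G : Type u} [Group G] {β : Type u} [Finite β] {n : ℕ}
    (θ : Language.groups.Formula (β ⊕ Fin 1)) {a : β → G}
    (ha : IsNormalNilpotentSet n (paramSet θ a))
    (hD : (definableFitting G : Set G) = paramSet θ a) (G' : Type v) [Group G']
    (h : Language.Theory.Model G' (Language.groups.completeTheory G)) :
    (definableFitting G' : Set G') = {x | (unionFormula n θ).Realize fun _ => x} := by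
  -- Seen as a family over an empty parameter type, so that `normalNilpotentFormula` applies to it
  -- and yields a sentence.
  let ψ : Language.groups.Formula (Empty ⊕ Fin 1) := (unionFormula n θ).relabel Sum.inr
  have hψG (w : Empty → G) : paramSet ψ w = definableFitting G := by
    ext x
    rw [mem_paramSet_relabel_inr, realize_unionFormula]
    refine ⟨fun ⟨v, hv, hx⟩ => hv.subset_definableFitting (paramSet_definable θ v) hx, fun hx => ?_⟩
    exact ⟨a, ha, hD ▸ hx⟩
  have hnil : IsNormalNilpotentSet n (paramSet ψ (Empty.elim : Empty → G')) := by
    refine (realize_normalNilpotentFormula n ψ _).1 (forall_realize_of_model h _ (fun w => ?_) _)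
    rw [realize_normalNilpotentFormula, hψG, hD]
    exact ha
  ext x
  rw [Set.mem_ofPred_eq, ← mem_paramSet_relabel_inr (v := Empty.elim)]
  refine ⟨fun hx => ?_, fun hx => hnil.subset_definableFitting (paramSet_definable ψ _) hx⟩
  obtain ⟨K, hK, -⟩ := hnil.exists_subgroup
  rw [← hK]
  refine (Subgroup.closure_le K).2 ?_ hx
  rintro y ⟨H, hH, hnor, hHnil, hy⟩
  -- The bound `m` depends on `H` and need not be related to `n`.
  obtain ⟨m, hm⟩ := exists_isNormalNilpotentSet H hnor hHnil
  obtain ⟨γ, _, χ, b, hχ⟩ := exists_paramSet_eq hH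
  rw [← hχ] at hm
  rw [hK, mem_paramSet_relabel_inr]
  refine realize_of_isNormalNilpotentSet_of_model h χ (fun c hc z hz => ?_) hm (hχ ▸ hy)
  rw [← mem_paramSet_relabel_inr (v := Empty.elim), hψG]
  exact hc.subset_definableFitting (paramSet_definable χ c) hz

end Formulas

end FirstOrder

theorem mainTheorem3 {G : Type u} [Group G] (D : Subgroup G)
    (hdef : FirstOrder.SubgroupDefinable D) (hnil : Group.IsNilpotent D)
    (hD : FirstOrder.definableFitting G = D) :
    ∃ ψ : FirstOrder.Language.groups.Formula (Fin 1),
      ∀ (G' : Type v) [Group G'],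
        FirstOrder.Language.Theory.Model G' (FirstOrder.Language.groups.completeTheory G) →
          ∀ x : G', x ∈ FirstOrder.definableFitting G' ↔ ψ.Realize ![x] := by
  obtain ⟨n, hn⟩ := FirstOrder.exists_isNormalNilpotentSet D
    (hD ▸ FirstOrder.definableFitting_normal) hnil
  obtain ⟨β, hβ, θ, a, ha⟩ := FirstOrder.exists_paramSet_eq hdef
  refine ⟨FirstOrder.unionFormula n θ, fun G' _ h x => ?_⟩
  have key := Set.ext_iff.1 (FirstOrder.definableFitting_eq_of_model θ (ha.symm ▸ hn)
    (by rw [hD, ha]) G' h) x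
  rw [Set.mem_ofPred_eq, ← Matrix.vec_single_eq_const] at key
  exact key
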